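/- Let $p$ be a prime and let $G$ be a finite $p$-group. For $H\le G$ put $m_G(H)=|H|\,|C_G(H)|$, and let $\mathcal{CD}(G)$ be the Chermak–Delgado lattice of $G$, that is, the set of subgroups $H\le G$ for which $m_G(H)$ is maximal, ordered by inclusion. Suppose that $\mathcal{CD}(G)$ is a quasi-antichain of width $w$, i.e. it consists of a maximum, a minimum and its atoms, and it has exactly $w$ atoms. Suppose further that $G$ has the following properties. (P1) Both $G/Z(G)$ and $G'$ are elementary abelian $p$-groups. (P2) For any two distinct atoms $M,N$ of $\mathcal{CD}(G)$, $M/Z(G)\cong N/Z(G)$ and $G/Z(G)=M/Z(G)\times N/Z(G)$ (internal direct product). (P3) Let $M_1\neq M_2$ be atoms of $\mathcal{CD}(G)$, and let $M_1=\langle x_1,\dots,x_n\rangle Z(G)$ and $M_2=\langle y_1,\dots,y_n\rangle Z(G)$, where $M_1/Z(G)$ and $M_2/Z(G)$ are elementary abelian of order $p^n$. Then for every atom $M\ne M_1,M_2$ there are $y_1',\dots,y_n'$ with $M=\langle x_1y_1',\dots,x_ny_n'\rangle Z(G)$ and $M_2=\langle y_1',\dots,y_n'\rangle Z(G)$, and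 there is an invertible matrix $C=(c_{ij})_{n\times n}$ over $\mathbb F_p$ such that $y_j'\equiv\prod_{i=1}^n y_i^{c_{ij}} \pmod{Z(G)}$ for $j=1,\dots,n$. Suppose that exactly $t>2$ of the atoms of $\mathcal{CD}(G)$ are abelian. Then there are positive integers $a$ and $b$ such that $w=p^a+1$ and $t=p^b+1$, where $a=b$ or $a=2b$. Moreover, if $|G/Z(G)|=p^{2n}$, then $a\mid n$. -/

import Mathlib

namespace ChermakDelgado

/-- A group is an elementary abelian `p`-group if it is abelian and `g ^ p = 1` for all `g`. -/
def IsElementaryAbelian (p : ℕ) (G : Type*) [Group G] : Prop :=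
  (∀ g h : G, g * h = h * g) ∧ ∀ g : G, g ^ p = 1

/-- An atom of a partially ordered set: an element that covers a minimum element. -/
def IsPosetAtom {P : Type*} [PartialOrder P] (x : P) : Prop :=
  ∃ b : P, IsBot b ∧ b ⋖ x

/-- A quasi-antichain consists of a maximum, a minimum, and atoms. (Such a partially ordered
set is automatically a lattice.) -/
structure IsQuasiAntichain (P : Type*) [PartialOrder P] : Prop where
  exists_min : ∃ b : P, IsBot b
  exists_max : ∃ m : P, IsTop m
  min_or_max_or_atom : ∀ x : P, IsBot x ∨ IsTop x ∨ IsPosetAtom x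

variable (p : ℕ) (G : Type*) [Group G]

/-- The Chermak-Delgado measure `m_G(H) = |H| |C_G(H)|` of a subgroup `H` of `G`. -/
noncomputable def measure {G : Type*} [Group G] (H : Subgroup G) : ℕ :=
  Nat.card H * Nat.card (Subgroup.centralizer (H : Set G))

/-- The Chermak-Delgado lattice `CD(G)`: the subgroups of maximal Chermak-Delgado measure,
ordered by inclusion. -/
def CD : Set (Subgroup G) :=
  {H | ∀ K : Subgroup G, measure K ≤ measure H}

/-- The set of atoms of the Chermak-Delgado lattice, as subgroups of `G`. -/
def atoms : Set (Subgroup G) :=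
  {M | ∃ h : M ∈ CD G, IsPosetAtom (⟨M, h⟩ : CD G)}

/-- The set of atoms of the Chermak-Delgado lattice that are abelian groups. -/
def abelianAtoms : Set (Subgroup G) :=
  {M | M ∈ atoms G ∧ ∀ g ∈ M, ∀ h ∈ M, g * h = h * g}

/-- The subgroup `M / Z(G)` of `G / Z(G)` (for `M` containing `Z(G)`; every member of `CD(G)`
contains `Z(G)`). -/
def modCenter {G : Type*} [Group G] (M : Subgroup G) : Subgroup (G ⧸ Subgroup.center G) :=
  M.map (QuotientGroup.mk' (Subgroup.center G))

/-- Both `G / Z(G)` and `G'` are elementary abelian `p`-groups. -/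
def P1 : Prop :=
  IsElementaryAbelian p (G ⧸ Subgroup.center G) ∧ IsElementaryAbelian p (commutator G)

/-- For distinct atoms `M`, `N` of `CD(G)`, the groups `M / Z(G)` and `N / Z(G)` are isomorphic
and `G / Z(G)` is their internal direct product. -/
def P2 : Prop :=
  ∀ M ∈ atoms G, ∀ N ∈ atoms G, M ≠ N →
    Nonempty (modCenter M ≃* modCenter N) ∧
    (modCenter M).Normal ∧ (modCenter N).Normal ∧ IsCompl (modCenter M) (modCenter N)

/-- The description of the other atoms in terms of generators of two atoms `M₁`, `M₂`: if
`M₁ = ⟨x₁, …, xₙ⟩ Z(G)` and `M₂ = ⟨y₁, …, yₙ⟩ Z(G)`, where `M₁ / Z(G)` and `M₂ / Z(G)` are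
elementary abelian of order `p ^ n`, then each atom `M` other than `M₁` and `M₂` has the form
`⟨x₁ y₁', …, xₙ yₙ'⟩ Z(G)`, where `M₂ = ⟨y₁', …, yₙ'⟩ Z(G)` and
`yⱼ' ≡ ∏ i, yᵢ ^ (C i j) mod Z(G)` for an invertible matrix `C` over `𝔽_p`. -/
def P3 : Prop :=
  ∀ M₁ ∈ atoms G, ∀ M₂ ∈ atoms G, M₁ ≠ M₂ →
    ∀ (n : ℕ) (x y : Fin n → G),
      M₁ = Subgroup.closure (Set.range x) ⊔ Subgroup.center G →
      M₂ = Subgroup.closure (Set.range y) ⊔ Subgroup.center G →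
      IsElementaryAbelian p (modCenter M₁) → Nat.card (modCenter M₁) = p ^ n →
      IsElementaryAbelian p (modCenter M₂) → Nat.card (modCenter M₂) = p ^ n →
      ∀ M ∈ atoms G, M ≠ M₁ → M ≠ M₂ →
        ∃ y' : Fin n → G,
          M = Subgroup.closure (Set.range fun i => x i * y' i) ⊔ Subgroup.center G ∧
          M₂ = Subgroup.closure (Set.range y') ⊔ Subgroup.center G ∧
          ∃ C : Matrix (Fin n) (Fin n) (ZMod p), IsUnit C ∧
            ∀ j : Fin n, (y' j : G ⧸ Subgroup.center G) =
              ((List.ofFn fun i : Fin n => y i ^ (C i j).val).prod : G)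

end ChermakDelgado

/-!
Since `G / Z(G)` is abelian, commutators are central and the commutator induces an alternating
nondegenerate biadditive form `B` on `V = G / Z(G)`. A subgroup `H` containing `Z(G)` corresponds
to a subspace `S` of `V`, its centralizer corresponds to the orthogonal `S^⊥`, and its
Chermak-Delgado measure is `|Z(G)|² |S| |S^⊥|`. An abelian atom is its own orthogonal
(`orthogonal_eq_self_of_abelian_atom`) and has order `|V|^(1/2)`, so the maximal measure is
`|Z(G)|² |V|` and the atoms are the proper nontrivial `S` with `|S| |S^⊥| = |V|`
(`pullback_mem_atoms_iff`); any two of them are complementary.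

Three abelian atoms give coordinates `V = U × U` in which they are the two axes and the diagonal
(`exists_equiv_prod_of_isCompl`). In these coordinates `B (u, u') (v, v') = β u v' - β v u'` for a
nondegenerate biadditive map `β` on `U`, which is symmetric because the diagonal is isotropic. Any
atom other than the vertical axis is the graph of an endomorphism `C` of `U`, and the graph of `C`
is an atom if and only if `C` has an adjoint `C*` with respect to `β`; the orthogonal of the graph
of `C` is then the graph of `C*`. So there are `|A| + 1` atoms, where `A` is the ring of
endomorphisms that have an adjoint, and the abelian ones are the vertical axis and the graphs of
the self-adjoint elements of `A` (`IsTripleIsotropic.ncard_maximalSubmodules`).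

Complementarity of the atoms makes every nonzero element of `A` injective. Hence `A` is a finite
domain, so a field by Wedderburn's theorem, and the adjoint is an automorphism of `A` of order at
most two. Its fixed field has index one or two in `A`, and `U` is a vector space over `A`
(`card_adjointable_selfAdjoint`).
-/

namespace ChermakDelgado

open scoped commutatorElement IsMulCommutative

/-! ### Involutions of finite fields -/

/-- The fixed elements of an involution of a field form a subfield of index at most two: if `σ`
moves `x`, then every `y` is uniquely `e + f x` with `e` and `f` fixed by `σ`. -/
theorem card_field_eq_or_eq_sq_card_fixed {F : Type*} [Field F] [Finite F] (σ : F →+* F)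
    (hσ : ∀ x, σ (σ x) = x) :
    Nat.card F = Nat.card (σ.eqLocusField (RingHom.id F)) ∨
      Nat.card F = Nat.card (σ.eqLocusField (RingHom.id F)) ^ 2 := by
  by_cases h : ∀ x, σ x = x
  · left
    have : σ.eqLocusField (RingHom.id F) = ⊤ := by
      ext x
      simp [h x, RingHom.eqLocusField]
    rw [this]
    exact (Nat.card_congr Subfield.topEquiv.toEquiv).symm
  · right
    push Not at h
    obtain ⟨x, hx⟩ := h
    have hx' : σ x - x ≠ 0 := sub_ne_zero.mpr hx
    have hx'' : x - σ x ≠ 0 := sub_ne_zero.mpr (Ne.symm hx)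
    set E := σ.eqLocusField (RingHom.id F) with hE
    have hmem : ∀ y, y ∈ E ↔ σ y = y := fun y => Iff.rfl
    rw [sq, ← Nat.card_prod]
    symm
    refine Nat.card_congr (Equiv.ofBijective (fun e : E × E => (e.1 : F) + e.2 * x) ⟨?_, ?_⟩)
    · rintro ⟨⟨a, ha⟩, ⟨b, hb⟩⟩ ⟨⟨c, hc⟩, ⟨d, hd⟩⟩ heq
      rw [hmem] at ha hb hc hd
      simp only at heq
      have h2 := congrArg σ heq
      simp only [map_add, map_mul, ha, hb, hc, hd] at h2
      have h3 : (b - d) * (σ x - x) = 0 := by linear_combination h2 - heq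
      have h4 : b = d := by
        rcases mul_eq_zero.mp h3 with h | h
        · exact sub_eq_zero.mp h
        · exact absurd h hx'
      subst h4
      have h5 : a = c := by simpa using heq
      subst h5
      rfl
    · intro y
      have hf : σ ((σ y - y) / (σ x - x)) = (σ y - y) / (σ x - x) := by
        simp only [map_div₀, map_sub, hσ]
        field_simp
        ring
      refine ⟨⟨⟨y - (σ y - y) / (σ x - x) * x, ?_⟩, ⟨(σ y - y) / (σ x - x), hf⟩⟩, by simp⟩
      rw [hmem, map_sub, map_mul, hf]
      field_simp
      ring

/-! ### Endomorphisms with an adjoint -/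

section Adjoint

variable {U W : Type*} [AddCommGroup U] [AddCommGroup W]

/-- The ring of endomorphisms of `U` that have an adjoint with respect to the biadditive
map `β`. -/
def adjointableSubring (β : U →+ U →+ W) : Subring (Module.End ℤ U) where
  carrier := {C | ∃ D : Module.End ℤ U, ∀ u v, β (C u) v = β u (D v)}
  mul_mem' := by
    rintro C C' ⟨D, hD⟩ ⟨D', hD'⟩
    exact ⟨D' * D, fun u v => by simp [hD, hD']⟩
  one_mem' := ⟨1, fun u v => rfl⟩
  add_mem' := by
    rintro C C' ⟨D, hD⟩ ⟨D', hD'⟩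
    exact ⟨D + D', fun u v => by simp [hD, hD']⟩
  zero_mem' := ⟨0, fun u v => by simp⟩
  neg_mem' := by
    rintro C ⟨D, hD⟩
    exact ⟨-D, fun u v => by simp [hD]⟩

/-- The endomorphisms of `U` that are self-adjoint with respect to `β`. -/
def selfAdjointSet (β : U →+ U →+ W) : Set (Module.End ℤ U) :=
  {C | ∀ u v, β (C u) v = β u (C v)}

/-- If all nonzero adjointable endomorphisms are injective, then they form a finite domain, hence
a field by Wedderburn's theorem. The adjoint is an involution of this field whose fixed elements
are the self-adjoint endomorphisms, and `U` is a vector space over it. -/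
theorem card_adjointable_selfAdjoint [Finite U] [Nontrivial U] (β : U →+ U →+ W)
    (hsymm : ∀ u v, β u v = β v u) (hnd : ∀ v, (∀ u, β u v = 0) → v = 0)
    {p : ℕ} (hp : p.Prime) (hpU : ∀ u : U, p • u = 0)
    (hinj : ∀ C ∈ adjointableSubring β, C ≠ 0 → ∀ u, C u = 0 → u = 0) :
    ∃ a b : ℕ, 0 < a ∧ 0 < b ∧ Nat.card (adjointableSubring β) = p ^ a ∧
      (selfAdjointSet β).ncard = p ^ b ∧ (a = b ∨ a = 2 * b) ∧
      ∀ n : ℕ, Nat.card U = p ^ n → a ∣ n := by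
  have : Finite (Module.End ℤ U) := Finite.of_injective _ DFunLike.coe_injective
  have : NoZeroDivisors (adjointableSubring β) := by
    refine ⟨fun {C C'} h => ?_⟩
    by_cases hC : C = 0
    · exact Or.inl hC
    · right
      ext u
      refine hinj C C.2 (fun h => hC (Subtype.ext h)) _ ?_
      exact DFunLike.congr_fun (congrArg Subtype.val h) u
  have : IsDomain (adjointableSubring β) := NoZeroDivisors.to_isDomain _
  let _ : Field (adjointableSubring β) :=
    (Finite.isDomain_to_isField (adjointableSubring β)).toField
  have huniq : ∀ D D' : Module.End ℤ U, (∀ u v, β u (D v) = β u (D' v)) → D = D' := by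
    intro D D' h
    ext v
    refine sub_eq_zero.mp (hnd _ fun u => ?_)
    rw [map_sub, h, sub_self]
  have hex : ∀ C : adjointableSubring β, ∃ D : adjointableSubring β,
      ∀ u v, β (C.1 u) v = β u (D.1 v) := by
    rintro ⟨C, D, hD⟩
    exact ⟨⟨D, C, fun u v => by rw [hsymm, ← hD, hsymm]⟩, hD⟩
  choose adj hadj using hex
  have hadj_eq : ∀ C D : adjointableSubring β, (∀ u v, β (C.1 u) v = β u (D.1 v)) →
      adj C = D := by
    intro C D h
    refine Subtype.ext (huniq _ _ fun u v => ?_)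
    rw [← hadj, h]
  let σ : adjointableSubring β →+* adjointableSubring β :=
    { toFun := adj
      map_one' := hadj_eq _ _ fun u v => rfl
      map_zero' := hadj_eq _ _ fun u v => by simp
      map_add' := fun C D => hadj_eq _ _ fun u v => by simp [hadj]
      map_mul' := fun C D => by
        -- The adjoint reverses products, and the ring is commutative.
        rw [mul_comm (adj C)]
        exact hadj_eq _ _ fun u v => by simp [hadj] }
  have hσσ : ∀ C, σ (σ C) = C := fun C => hadj_eq _ _ fun u v => by
    change β ((adj C).1 u) v = β u (C.1 v)
    rw [hsymm, ← hadj, hsymm]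
  have : Fact p.Prime := ⟨hp⟩
  have hchar : CharP (adjointableSubring β) p := by
    refine (CharP.charP_iff_prime_eq_zero hp).mpr (Subtype.ext (LinearMap.ext fun u => ?_))
    have := hpU u
    simpa [Module.End.natCast_apply] using this
  set E := σ.eqLocusField (RingHom.id (adjointableSubring β)) with hE
  have hcharE : CharP E p := by
    refine (CharP.charP_iff_prime_eq_zero hp).mpr (Subtype.ext ?_)
    simp
  have hcardE : (selfAdjointSet β).ncard = Nat.card E := by
    rw [← Nat.card_coe_set_eq]
    refine Nat.card_congr
      { toFun := fun C => ⟨⟨C.1, C.1, C.2⟩, hadj_eq _ _ C.2⟩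
        invFun := fun C => ⟨C.1.1, fun u v => ?_⟩
        left_inv := fun C => rfl
        right_inv := fun C => rfl }
    have h1 : adj C.1 = C.1 := C.2
    have h2 := hadj C.1 u v
    rwa [h1] at h2
  cases nonempty_fintype (adjointableSubring β)
  cases nonempty_fintype E
  obtain ⟨a, -, ha⟩ := FiniteField.card (adjointableSubring β) p
  obtain ⟨b, -, hb⟩ := FiniteField.card E p
  rw [← Nat.card_eq_fintype_card] at ha hb
  refine ⟨a, b, a.pos, b.pos, ha, by rw [hcardE, hb], ?_, ?_⟩
  · have h := card_field_eq_or_eq_sq_card_fixed σ hσσ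
    rw [← hE, ha, hb, ← pow_mul] at h
    refine h.imp (fun h => Nat.pow_right_injective hp.two_le h) fun h => ?_
    rw [mul_comm]
    exact Nat.pow_right_injective hp.two_le h
  · intro n hn
    let _ : Module (adjointableSubring β) U := Module.compHom U (adjointableSubring β).subtype
    have h := Module.natCard_eq_pow_finrank (K := adjointableSubring β) (V := U)
    rw [hn, ha, ← pow_mul] at h
    exact ⟨_, Nat.pow_right_injective hp.two_le h⟩

end Adjoint

/-! ### Subspaces of maximal measure for a biadditive form -/

section Form

variable {V W : Type*} [AddCommGroup V] [AddCommGroup W]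

/-- The right orthogonal of `S` with respect to the biadditive map `B`. -/
def orthogonal (B : V →+ V →+ W) (S : Submodule ℤ V) : Submodule ℤ V where
  carrier := {v | ∀ s ∈ S, B s v = 0}
  add_mem' := fun {a b} ha hb s hs => by simp [ha s hs, hb s hs]
  zero_mem' := fun s _ => map_zero _
  smul_mem' := fun c v hv s hs => by simp [hv s hs]

theorem mem_orthogonal {B : V →+ V →+ W} {S : Submodule ℤ V} {v : V} :
    v ∈ orthogonal B S ↔ ∀ s ∈ S, B s v = 0 :=
  Iff.rfl

theorem orthogonal_bot (B : V →+ V →+ W) : orthogonal B ⊥ = ⊤ := by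
  ext v
  simp [mem_orthogonal]

/-- The proper nontrivial `S` with `|S| |S^⊥| = |V|`. For the commutator form on `V = G / Z(G)`
these are the images of the members of the Chermak-Delgado lattice other than `Z(G)` and `G`. -/
def maximalSubmodules (B : V →+ V →+ W) : Set (Submodule ℤ V) :=
  {S | S ≠ ⊥ ∧ S ≠ ⊤ ∧ Nat.card S * Nat.card (orthogonal B S) = Nat.card V}

/-- The members of `maximalSubmodules B` that are totally isotropic. -/
def isotropicMaximalSubmodules (B : V →+ V →+ W) : Set (Submodule ℤ V) :=
  {S | S ∈ maximalSubmodules B ∧ S ≤ orthogonal B S}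

theorem card_mul_card_of_isCompl {S T : Submodule ℤ V} (h : IsCompl S T) :
    Nat.card S * Nat.card T = Nat.card V := by
  rw [← Nat.card_prod]
  exact Nat.card_congr (Submodule.prodEquivOfIsCompl S T h).toEquiv

end Form

section Plane

variable {U W : Type*} [AddCommGroup U] [AddCommGroup W]

theorem graph_injective {R M N : Type*} [Ring R] [AddCommGroup M] [AddCommGroup N] [Module R M]
    [Module R N] : Function.Injective (LinearMap.graph : (M →ₗ[R] N) → Submodule R (M × N)) := by
  intro C D h
  ext u
  have : (u, C u) ∈ D.graph := by rw [← h]; simp [LinearMap.mem_graph_iff]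
  simpa [LinearMap.mem_graph_iff] using this

theorem card_graph (C : Module.End ℤ U) : Nat.card C.graph = Nat.card U :=
  Nat.card_congr
    { toFun := fun x => x.1.1
      invFun := fun u => ⟨(u, C u), by simp [LinearMap.mem_graph_iff]⟩
      left_inv := fun x => Subtype.ext (Prod.ext rfl ((LinearMap.mem_graph_iff C x.1).mp x.2).symm)
      right_inv := fun u => rfl }

theorem vertical_notMem_graphs [Nontrivial U] (A : Set (Module.End ℤ U)) :
    (Submodule.prod ⊥ ⊤ : Submodule ℤ (U × U)) ∉ LinearMap.graph '' A := by
  rintro ⟨C, -, h⟩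
  obtain ⟨u, hu⟩ := exists_ne (0 : U)
  have : ((0, u) : U × U) ∈ C.graph := by rw [h]; simp
  exact hu (by simpa [LinearMap.mem_graph_iff] using this)

/-- A subgroup of `U × U` of the order of `U` that meets the vertical axis trivially is a graph. -/
theorem exists_eq_graph_of_card [Finite U] {S : Submodule ℤ (U × U)}
    (hcard : Nat.card S = Nat.card U) (h : ∀ v, ((0, v) : U × U) ∈ S → v = 0) :
    ∃ C : Module.End ℤ U, S = C.graph := by
  refine Submodule.exists_eq_graph ?_
  rw [Nat.bijective_iff_injective_and_card]
  refine ⟨?_, hcard⟩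
  rintro ⟨⟨a, b⟩, hab⟩ ⟨⟨c, d⟩, hcd⟩ (hac : a = c)
  subst hac
  have h1 := S.sub_mem hab hcd
  simp only [Prod.mk_sub_mk, sub_self] at h1
  have h2 := sub_eq_zero.mp (h _ h1)
  subst h2
  rfl

/-- The pairing `(u, v) ↦ B (u, 0) (0, v)` of the two axes induced by a biadditive map on
`U × U`. -/
def axisPairing (B : (U × U) →+ (U × U) →+ W) : U →+ U →+ W :=
  (AddMonoidHom.compHom.flip (AddMonoidHom.inr U U)).comp (B.comp (AddMonoidHom.inl U U))

theorem axisPairing_apply (B : (U × U) →+ (U × U) →+ W) (u v : U) :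
    axisPairing B u v = B (u, 0) (0, v) :=
  rfl

/-- A biadditive map on `U × U` that is antisymmetric and nondegenerate, and for which the two
axes and the diagonal are totally isotropic. -/
structure IsTripleIsotropic (B : (U × U) →+ (U × U) →+ W) : Prop where
  antisymm : ∀ x y, B x y = -B y x
  nondegenerate : ∀ y, (∀ x, B x y = 0) → y = 0
  horizontal : ∀ u v, B (u, 0) (v, 0) = 0
  vertical : ∀ u v, B (0, u) (0, v) = 0
  diagonal : ∀ u v, B (u, u) (v, v) = 0

namespace IsTripleIsotropic

variable {B : (U × U) →+ (U × U) →+ W} (hB : IsTripleIsotropic B)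
include hB

theorem apply_eq (u u' v v' : U) :
    B (u, u') (v, v') = axisPairing B u v' - axisPairing B v u' := by
  have h1 : ((u, u') : U × U) = (u, 0) + (0, u') := by simp
  have h2 : ((v, v') : U × U) = (v, 0) + (0, v') := by simp
  rw [h1, h2]
  simp only [map_add, AddMonoidHom.add_apply, hB.horizontal, hB.vertical, axisPairing_apply]
  rw [hB.antisymm (0, u') (v, 0)]
  abel

theorem axisPairing_comm (u v : U) : axisPairing B u v = axisPairing B v u := by
  have := hB.diagonal u v
  rw [hB.apply_eq] at this
  exact sub_eq_zero.mp this

theorem axisPairing_nondegenerate (v : U) (h : ∀ u, axisPairing B u v = 0) : v = 0 := by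
  have : ((0, v) : U × U) = 0 := hB.nondegenerate _ fun ⟨x, y⟩ => by
    rw [hB.apply_eq, h]
    simp
  exact congrArg Prod.snd this

theorem mem_orthogonal_graph_iff (C : Module.End ℤ U) (v v' : U) :
    (v, v') ∈ orthogonal B C.graph ↔ ∀ u, axisPairing B (C u) v = axisPairing B u v' := by
  simp only [mem_orthogonal, Prod.forall, LinearMap.mem_graph_iff, forall_eq, hB.apply_eq]
  refine forall_congr' fun u => ?_
  rw [sub_eq_zero, hB.axisPairing_comm v, eq_comm]

theorem orthogonal_graph {C D : Module.End ℤ U}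
    (h : ∀ u v, axisPairing B (C u) v = axisPairing B u (D v)) :
    orthogonal B C.graph = D.graph := by
  ext ⟨v, v'⟩
  rw [hB.mem_orthogonal_graph_iff, LinearMap.mem_graph_iff]
  refine ⟨fun h' => sub_eq_zero.mp (hB.axisPairing_nondegenerate _ fun u => ?_), ?_⟩
  · rw [map_sub, ← h' u, ← h, sub_self]
  · rintro (rfl : v' = D v) u
    exact h u v

theorem orthogonal_vertical :
    orthogonal B (Submodule.prod ⊥ ⊤) = Submodule.prod ⊥ ⊤ := by
  ext ⟨v, v'⟩
  simp only [mem_orthogonal, Prod.forall, Submodule.mem_prod, Submodule.mem_bot,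
    Submodule.mem_top, and_true, hB.apply_eq]
  refine ⟨fun h => hB.axisPairing_nondegenerate v fun u => ?_, ?_⟩
  · simpa [hB.axisPairing_comm u v] using h 0 u rfl
  · rintro rfl u _ rfl
    simp

theorem vertical_mem [Nontrivial U] :
    Submodule.prod ⊥ ⊤ ∈ maximalSubmodules B := by
  obtain ⟨u, hu⟩ := exists_ne (0 : U)
  refine ⟨fun h => hu ?_, fun h => hu ?_, ?_⟩
  · have : ((0, u) : U × U) ∈ (Submodule.prod ⊥ ⊤ : Submodule ℤ (U × U)) := by simp
    rw [h] at this
    simpa using this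
  · have : ((u, 0) : U × U) ∈ (Submodule.prod ⊥ ⊤ : Submodule ℤ (U × U)) := by rw [h]; trivial
    simpa using this
  · have : Nat.card (Submodule.prod ⊥ ⊤ : Submodule ℤ (U × U)) = Nat.card U :=
      Nat.card_congr
        { toFun := fun x => x.1.2
          invFun := fun u => ⟨(0, u), by simp⟩
          left_inv := fun x => Subtype.ext (Prod.ext (by
            have := x.2
            simp only [Submodule.mem_prod, Submodule.mem_bot] at this
            exact this.1.symm) rfl)
          right_inv := fun u => rfl }
    rw [hB.orthogonal_vertical, this, Nat.card_prod]

theorem graph_mem [Nontrivial U] {C : Module.End ℤ U}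
    (hC : C ∈ adjointableSubring (axisPairing B)) : C.graph ∈ maximalSubmodules B := by
  obtain ⟨D, hD⟩ := hC
  obtain ⟨u, hu⟩ := exists_ne (0 : U)
  refine ⟨fun h => hu ?_, fun h => hu ?_, ?_⟩
  · have : ((u, C u) : U × U) ∈ C.graph := by simp [LinearMap.mem_graph_iff]
    rw [h] at this
    exact congrArg Prod.fst ((Submodule.mem_bot _).mp this)
  · have : ((0, u) : U × U) ∈ C.graph := by rw [h]; trivial
    simpa [LinearMap.mem_graph_iff] using this
  · rw [hB.orthogonal_graph hD, card_graph, card_graph, Nat.card_prod]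

/-- If `S` is a member other than the vertical axis, both `S` and its orthogonal are graphs,
of endomorphisms that are adjoint to each other. -/
theorem exists_eq_graph_of_mem [Finite U] [Nontrivial U]
    (hcompl : ∀ S ∈ maximalSubmodules B, ∀ T ∈ maximalSubmodules B, S ≠ T → IsCompl S T)
    {S : Submodule ℤ (U × U)} (hS : S ∈ maximalSubmodules B) (hne : S ≠ Submodule.prod ⊥ ⊤) :
    ∃ C ∈ adjointableSubring (axisPairing B), C.graph = S := by
  have hc := hcompl S hS _ hB.vertical_mem hne
  have hpos : 0 < Nat.card U := Nat.card_pos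
  have hvert := hB.vertical_mem.2.2
  rw [hB.orthogonal_vertical, Nat.card_prod] at hvert
  have hvert' := Nat.mul_self_inj.mp hvert
  have hcard := card_mul_card_of_isCompl hc
  rw [hvert', Nat.card_prod] at hcard
  have hcardS := Nat.eq_of_mul_eq_mul_right hpos hcard
  have hcardO := hS.2.2
  rw [hcardS, Nat.card_prod] at hcardO
  have hcardO := Nat.eq_of_mul_eq_mul_left hpos hcardO
  obtain ⟨C, rfl⟩ := exists_eq_graph_of_card hcardS fun v hv => by
    have := (Submodule.disjoint_def.mp hc.disjoint) (0, v) hv (by simp)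
    exact congrArg Prod.snd this
  obtain ⟨D, hD⟩ := exists_eq_graph_of_card hcardO fun v hv => by
    rw [hB.mem_orthogonal_graph_iff] at hv
    exact hB.axisPairing_nondegenerate v fun u => by rw [← hv u, map_zero]
  refine ⟨C, ⟨D, fun u v => ?_⟩, rfl⟩
  have : (v, D v) ∈ orthogonal B C.graph := by rw [hD]; simp [LinearMap.mem_graph_iff]
  exact (hB.mem_orthogonal_graph_iff C v (D v)).mp this u

theorem maximalSubmodules_eq [Finite U] [Nontrivial U]
    (hcompl : ∀ S ∈ maximalSubmodules B, ∀ T ∈ maximalSubmodules B, S ≠ T → IsCompl S T) :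
    maximalSubmodules B = insert (Submodule.prod ⊥ ⊤)
      (LinearMap.graph '' (adjointableSubring (axisPairing B) : Set (Module.End ℤ U))) := by
  ext S
  constructor
  · intro hS
    by_cases hne : S = Submodule.prod ⊥ ⊤
    · exact Or.inl hne
    · exact Or.inr (hB.exists_eq_graph_of_mem hcompl hS hne)
  · rintro (rfl | ⟨C, hC, rfl⟩)
    · exact hB.vertical_mem
    · exact hB.graph_mem hC

theorem isotropicMaximalSubmodules_eq [Finite U] [Nontrivial U]
    (hcompl : ∀ S ∈ maximalSubmodules B, ∀ T ∈ maximalSubmodules B, S ≠ T → IsCompl S T) :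
    isotropicMaximalSubmodules B = insert (Submodule.prod ⊥ ⊤)
      (LinearMap.graph '' selfAdjointSet (axisPairing B)) := by
  ext S
  constructor
  · rintro ⟨hS, hiso⟩
    by_cases hne : S = Submodule.prod ⊥ ⊤
    · exact Or.inl hne
    · obtain ⟨C, -, rfl⟩ := hB.exists_eq_graph_of_mem hcompl hS hne
      refine Or.inr ⟨C, fun u v => ?_, rfl⟩
      have : (v, C v) ∈ orthogonal B C.graph := hiso (by simp [LinearMap.mem_graph_iff])
      exact (hB.mem_orthogonal_graph_iff C v (C v)).mp this u
  · rintro (rfl | ⟨C, hC, rfl⟩)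
    · exact ⟨hB.vertical_mem, hB.orthogonal_vertical.ge⟩
    · exact ⟨hB.graph_mem ⟨C, hC⟩, (hB.orthogonal_graph hC).ge⟩

/-- The graph of an adjointable endomorphism `C ≠ 0` is complementary to the horizontal axis, the
graph of `0`; so `C` is injective and `card_adjointable_selfAdjoint` applies. -/
theorem ncard_maximalSubmodules [Finite U] [Nontrivial U]
    (hcompl : ∀ S ∈ maximalSubmodules B, ∀ T ∈ maximalSubmodules B, S ≠ T → IsCompl S T)
    {p : ℕ} (hp : p.Prime) (hpU : ∀ u : U, p • u = 0) :
    ∃ a b : ℕ, 0 < a ∧ 0 < b ∧ (maximalSubmodules B).ncard = p ^ a + 1 ∧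
      (isotropicMaximalSubmodules B).ncard = p ^ b + 1 ∧ (a = b ∨ a = 2 * b) ∧
      ∀ n : ℕ, Nat.card U = p ^ n → a ∣ n := by
  have : Finite (Module.End ℤ U) := Finite.of_injective _ DFunLike.coe_injective
  obtain ⟨a, b, ha, hb, hA, hS, hab, hn⟩ := card_adjointable_selfAdjoint (axisPairing B)
    hB.axisPairing_comm hB.axisPairing_nondegenerate hp hpU (by
      intro C hC hC0 u hu
      have hc := hcompl _ (hB.graph_mem hC) _ (hB.graph_mem (zero_mem _))
        (fun h => hC0 (graph_injective h))
      have := (Submodule.disjoint_def.mp hc.disjoint) (u, 0)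
        (by simp [LinearMap.mem_graph_iff, hu]) (by simp [LinearMap.mem_graph_iff])
      exact congrArg Prod.fst this)
  refine ⟨a, b, ha, hb, ?_, ?_, hab, hn⟩
  · rw [hB.maximalSubmodules_eq hcompl,
      Set.ncard_insert_of_notMem (vertical_notMem_graphs _) (Set.toFinite _),
      Set.ncard_image_of_injective _ graph_injective, ← hA, ← Nat.card_coe_set_eq]
    rfl
  · rw [hB.isotropicMaximalSubmodules_eq hcompl,
      Set.ncard_insert_of_notMem (vertical_notMem_graphs _) (Set.toFinite _),
      Set.ncard_image_of_injective _ graph_injective, hS]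

end IsTripleIsotropic

end Plane

/-- For three pairwise complementary subspaces, coordinates in `S₁ × S₁` can be chosen in which
they are the horizontal axis, the vertical axis and the diagonal. -/
theorem exists_equiv_prod_of_isCompl {V : Type*} [AddCommGroup V] {S₁ S₂ S₃ : Submodule ℤ V}
    (h12 : IsCompl S₁ S₂) (h13 : IsCompl S₁ S₃) (h23 : IsCompl S₂ S₃) :
    ∃ e : V ≃ₗ[ℤ] S₁ × S₁, (∀ v, v ∈ S₁ ↔ (e v).2 = 0) ∧ (∀ v, v ∈ S₂ ↔ (e v).1 = 0) ∧
      ∀ v, v ∈ S₃ ↔ (e v).1 = (e v).2 := by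
  -- The coordinates are the projection along `S₂` and its difference from that along `S₃`.
  set f := S₁.projectionOnto S₂ h12 with hf
  set g := S₁.projectionOnto S₃ h13 with hg
  have hf0 : ∀ v, f v = 0 ↔ v ∈ S₂ := fun v => Submodule.projectionOnto_apply_eq_zero_iff h12
  have hg0 : ∀ v, g v = 0 ↔ v ∈ S₃ := fun v => Submodule.projectionOnto_apply_eq_zero_iff h13
  have hf1 : ∀ x : S₁, f x = x := Submodule.projectionOnto_apply_left h12
  have hg1 : ∀ x : S₁, g x = x := Submodule.projectionOnto_apply_left h13
  have hinj : ∀ v, f v = 0 → g v = 0 → v = 0 := fun v h2 h3 =>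
    (Submodule.disjoint_def.mp h23.disjoint) v ((hf0 v).mp h2) ((hg0 v).mp h3)
  let e : V →ₗ[ℤ] S₁ × S₁ := f.prod (f - g)
  have he : Function.Bijective e := by
    refine ⟨(injective_iff_map_eq_zero e).mpr fun v hv => ?_, fun ⟨a, b⟩ => ?_⟩
    · have h1 : f v = 0 := congrArg Prod.fst hv
      have h2 : f v - g v = 0 := congrArg Prod.snd hv
      exact hinj v h1 (by rwa [h1, zero_sub, neg_eq_zero] at h2)
    · obtain ⟨y, hy, z, hz, hyz⟩ := Submodule.mem_sup.mp
        (show (b : V) ∈ S₂ ⊔ S₃ by rw [h23.sup_eq_top]; trivial)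
      rw [← hf0] at hy
      have hgy : g y = b := by
        rw [← hg1 b, ← hyz, map_add, (hg0 z).mpr hz, add_zero]
      refine ⟨a - y, Prod.ext ?_ ?_⟩
      · change f (a - y) = a
        rw [map_sub, hf1, hy, sub_zero]
      · change f (a - y) - g (a - y) = b
        rw [map_sub, map_sub, hf1, hg1, hy, hgy]
        abel
  refine ⟨LinearEquiv.ofBijective e he, fun v => ?_, fun v => (hf0 v).symm, fun v => ?_⟩
  · change v ∈ S₁ ↔ f v - g v = 0
    constructor
    · intro hv
      rw [hf1 ⟨v, hv⟩, hg1 ⟨v, hv⟩, sub_self]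
    · intro h
      have : v - f v = 0 := hinj _ (by rw [map_sub, hf1, sub_self])
        (by rw [map_sub, hg1, ← neg_sub, h, neg_zero])
      rw [sub_eq_zero.mp this]
      exact (f v).2
  · change v ∈ S₃ ↔ f v = f v - g v
    rw [← hg0, eq_comm (a := f v), sub_eq_self]

/-! ### The commutator form on the central quotient -/

section Pullback

variable {G V : Type*} [Group G] [AddCommGroup V]

/-- The preimage in `G` of a subgroup of `V` under `q : G → V`. The target `V` is written
additively and its subgroups as `ℤ`-submodules. -/
def pullback (q : G →* Multiplicative V) (S : Submodule ℤ V) : Subgroup G :=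
  (AddSubgroup.toSubgroup S.toAddSubgroup).comap q

theorem mem_pullback {q : G →* Multiplicative V} {S : Submodule ℤ V} {g : G} :
    g ∈ pullback q S ↔ (q g).toAdd ∈ S :=
  Iff.rfl

/-- The form `B` on the central quotient `V` of `G` is induced by the commutator. Its values are
in the center, written additively. -/
def IsCommutatorForm (q : G →* Multiplicative V)
    (B : V →+ V →+ Additive (Subgroup.center G)) : Prop :=
  ∀ g h, ((B (q g).toAdd (q h).toAdd).toMul : G) = ⁅g, h⁆

/-- The homomorphism `q` identifies the additive group `V` with the central quotient
`G / Z(G)`. -/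
structure IsCentralQuotient (q : G →* Multiplicative V) : Prop where
  surjective : Function.Surjective q
  ker_eq : q.ker = Subgroup.center G

namespace IsCentralQuotient

variable {q : G →* Multiplicative V} (hq : IsCentralQuotient q)
include hq

theorem exists_lift (v : V) : ∃ g, (q g).toAdd = v :=
  hq.surjective (Multiplicative.ofAdd v)

theorem toAdd_eq_zero_iff (g : G) : (q g).toAdd = 0 ↔ g ∈ Subgroup.center G := by
  rw [← hq.ker_eq, MonoidHom.mem_ker]
  rfl

theorem pullback_le_iff {S T : Submodule ℤ V} : pullback q S ≤ pullback q T ↔ S ≤ T := by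
  refine ⟨fun h v hv => ?_, fun h g hg => h hg⟩
  obtain ⟨g, rfl⟩ := hq.exists_lift v
  exact h hv

theorem pullback_injective : Function.Injective (pullback q) := fun _ _ h =>
  le_antisymm (hq.pullback_le_iff.mp h.le) (hq.pullback_le_iff.mp h.ge)

theorem center_le_pullback (S : Submodule ℤ V) : Subgroup.center G ≤ pullback q S := by
  intro g hg
  rw [mem_pullback, (hq.toAdd_eq_zero_iff g).mpr hg]
  exact S.zero_mem

theorem pullback_bot : pullback q ⊥ = Subgroup.center G := by
  ext g
  rw [mem_pullback, Submodule.mem_bot, hq.toAdd_eq_zero_iff]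

theorem exists_pullback_eq {H : Subgroup G} (hH : Subgroup.center G ≤ H) :
    ∃ S : Submodule ℤ V, pullback q S = H := by
  refine ⟨AddSubgroup.toIntSubmodule (Subgroup.toAddSubgroup' (H.map q)), ?_⟩
  have : pullback q (AddSubgroup.toIntSubmodule (Subgroup.toAddSubgroup' (H.map q))) =
      (H.map q).comap q := rfl
  rw [this, Subgroup.comap_map_eq, hq.ker_eq, sup_eq_left]
  exact hH

theorem card_eq [Finite G] : Nat.card G = Nat.card (Subgroup.center G) * Nat.card V := by
  rw [← (Subgroup.center G).card_mul_index, ← hq.ker_eq, Subgroup.index_ker,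
    MonoidHom.range_eq_top.mpr hq.surjective, Nat.card_congr Subgroup.topEquiv.toEquiv]
  rfl

theorem card_pullback [Finite G] (S : Submodule ℤ V) :
    Nat.card (pullback q S) = Nat.card (Subgroup.center G) * Nat.card S := by
  set S' := AddSubgroup.toSubgroup S.toAddSubgroup with hS'
  have hidx : (pullback q S).index = S'.index := Subgroup.index_comap_of_surjective _ hq.surjective
  have h1 := (pullback q S).card_mul_index
  have h2 : Nat.card S * S'.index = Nat.card V := S'.card_mul_index
  rw [hidx, hq.card_eq, ← h2, ← mul_assoc] at h1
  have : Finite V := Finite.of_surjective _ hq.surjective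
  have hpos : S'.index ≠ 0 := fun h => by
    rw [h, mul_zero] at h2
    exact Nat.card_pos.ne h2
  exact Nat.eq_of_mul_eq_mul_right (Nat.pos_of_ne_zero hpos) h1

theorem commutator_mem_center (g h : G) : ⁅g, h⁆ ∈ Subgroup.center G := by
  rw [← hq.ker_eq, MonoidHom.mem_ker, map_commutatorElement]
  exact (Commute.all _ _).commutator_eq

theorem commutator_mul_left (g g' h : G) : ⁅g * g', h⁆ = ⁅g, h⁆ * ⁅g', h⁆ := by
  rw [commutatorElement_mul_left_eq_conj_mul,
    Subgroup.mem_center_iff.mp (hq.commutator_mem_center g' h) g, mul_inv_cancel_right,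
    Subgroup.mem_center_iff.mp (hq.commutator_mem_center g h)]

theorem commutator_mul_right (g h h' : G) : ⁅g, h * h'⁆ = ⁅g, h⁆ * ⁅g, h'⁆ := by
  rw [← commutatorElement_inv, hq.commutator_mul_left, mul_inv_rev, commutatorElement_inv,
    commutatorElement_inv, Subgroup.mem_center_iff.mp (hq.commutator_mem_center g h)]

theorem commutator_congr {g g' h h' : G} (hg : q g = q g') (hh : q h = q h') :
    ⁅g, h⁆ = ⁅g', h'⁆ := by
  have key : ∀ a b : G, q a = q b → ∃ z ∈ Subgroup.center G, a = b * z := fun a b hab =>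
    ⟨b⁻¹ * a, by rw [← hq.ker_eq, MonoidHom.mem_ker, map_mul, map_inv, hab, inv_mul_cancel],
      by rw [mul_inv_cancel_left]⟩
  obtain ⟨z, hz, rfl⟩ := key _ _ hg
  obtain ⟨y, hy, rfl⟩ := key _ _ hh
  have h1 : ∀ x : G, ⁅z, x⁆ = 1 := fun x =>
    commutatorElement_eq_one_iff_mul_comm.mpr (Subgroup.mem_center_iff.mp hz x).symm
  have h2 : ∀ x : G, ⁅x, y⁆ = 1 := fun x =>
    commutatorElement_eq_one_iff_mul_comm.mpr (Subgroup.mem_center_iff.mp hy x)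
  rw [hq.commutator_mul_left, h1, mul_one, hq.commutator_mul_right, h2, mul_one]

/-- The commutator induces a biadditive form on the central quotient, since commutators are
central. -/
theorem exists_commutatorForm :
    ∃ B : V →+ V →+ Additive (Subgroup.center G), IsCommutatorForm q B := by
  choose s hs using hq.exists_lift
  have hs' : ∀ v w, q (s (v + w)) = q (s v * s w) := fun v w => by
    apply Multiplicative.toAdd.injective
    rw [map_mul, toAdd_mul, hs, hs, hs]
  refine ⟨AddMonoidHom.mk' (fun v => AddMonoidHom.mk' (fun w =>
    Additive.ofMul ⟨⁅s v, s w⁆, hq.commutator_mem_center _ _⟩) fun w w' => ?_) fun v v' => ?_,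
    fun g h => ?_⟩
  · apply Additive.toMul.injective
    apply Subtype.ext
    exact (hq.commutator_congr rfl (hs' w w')).trans (hq.commutator_mul_right _ _ _)
  · ext w
    exact (hq.commutator_congr (hs' v v') rfl).trans (hq.commutator_mul_left _ _ _)
  · exact hq.commutator_congr (Multiplicative.toAdd.injective (hs _))
      (Multiplicative.toAdd.injective (hs _))

end IsCentralQuotient

namespace IsCommutatorForm

variable {q : G →* Multiplicative V} {B : V →+ V →+ Additive (Subgroup.center G)}
  (hB : IsCommutatorForm q B)
include hB

theorem apply_eq_zero_iff (g h : G) : B (q g).toAdd (q h).toAdd = 0 ↔ g * h = h * g := by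
  rw [← commutatorElement_eq_one_iff_mul_comm, ← hB, ← toMul_eq_one, OneMemClass.coe_eq_one]

variable (hq : IsCentralQuotient q)
include hq

theorem antisymm (v w : V) : B v w = -B w v := by
  obtain ⟨g, rfl⟩ := hq.exists_lift v
  obtain ⟨h, rfl⟩ := hq.exists_lift w
  apply Additive.toMul.injective
  apply Subtype.ext
  rw [toMul_neg, Subgroup.coe_inv, hB, hB, commutatorElement_inv]

theorem nondegenerate (w : V) (h : ∀ v, B v w = 0) : w = 0 := by
  obtain ⟨g, rfl⟩ := hq.exists_lift w
  rw [hq.toAdd_eq_zero_iff, Subgroup.mem_center_iff]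
  exact fun k => (hB.apply_eq_zero_iff k g).mp (h _)

theorem centralizer_pullback (S : Submodule ℤ V) :
    Subgroup.centralizer (pullback q S : Set G) = pullback q (orthogonal B S) := by
  ext g
  rw [mem_pullback, mem_orthogonal, Subgroup.mem_centralizer_iff]
  constructor
  · intro h v hv
    obtain ⟨k, rfl⟩ := hq.exists_lift v
    exact (hB.apply_eq_zero_iff k g).mpr (h k hv)
  · exact fun h k hk => (hB.apply_eq_zero_iff k g).mp (h _ hk)

theorem measure_pullback [Finite G] (S : Submodule ℤ V) :
    measure (pullback q S) =
      Nat.card (Subgroup.center G) ^ 2 * (Nat.card S * Nat.card (orthogonal B S)) := by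
  rw [measure, hB.centralizer_pullback hq, hq.card_pullback, hq.card_pullback]
  ring

theorem orthogonal_top : orthogonal B ⊤ = ⊥ := by
  rw [eq_bot_iff]
  exact fun v hv => hB.nondegenerate hq v fun w => hv w trivial

theorem commute_pullback_iff (S : Submodule ℤ V) :
    (∀ g ∈ pullback q S, ∀ h ∈ pullback q S, g * h = h * g) ↔ S ≤ orthogonal B S := by
  constructor
  · intro h v hv w hw
    obtain ⟨g, rfl⟩ := hq.exists_lift v
    obtain ⟨k, rfl⟩ := hq.exists_lift w
    exact (hB.apply_eq_zero_iff k g).mpr (h k hw g hv)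
  · exact fun h g hg k hk => (hB.apply_eq_zero_iff g k).mp (h hk _ hg)

end IsCommutatorForm

end Pullback

/-! ### Members of the Chermak-Delgado lattice -/

section Lattice

variable {G V : Type*} [Group G] [AddCommGroup V]

theorem center_le_of_mem_CD [Finite G] {H : Subgroup G} (hH : H ∈ CD G) :
    Subgroup.center G ≤ H := by
  -- `H` and `H Z(G)` have the same centralizer, so maximality of the measure gives `H Z(G) = H`.
  have hcent : Subgroup.centralizer ((H ⊔ Subgroup.center G : Subgroup G) : Set G) =
      Subgroup.centralizer (H : Set G) := by
    refine le_antisymm (Subgroup.centralizer_le (SetLike.coe_subset_coe.mpr le_sup_left)) ?_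
    rw [Subgroup.le_centralizer_iff]
    refine sup_le ?_ (Subgroup.center_le_centralizer _)
    rw [Subgroup.le_centralizer_iff]
  have h := hH (H ⊔ Subgroup.center G)
  rw [measure, measure, hcent] at h
  have hle := Nat.le_of_mul_le_mul_right h Nat.card_pos
  have := Subgroup.eq_of_le_of_card_ge (le_sup_left : H ≤ H ⊔ Subgroup.center G) hle
  rw [this]
  exact le_sup_right

theorem center_lt_of_mem_atoms [Finite G] {M : Subgroup G} (hM : M ∈ atoms G) :
    Subgroup.center G < M := by
  obtain ⟨h, b, -, hb⟩ := hM
  exact lt_of_le_of_lt (center_le_of_mem_CD b.2) hb.lt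

theorem mk_mem_modCenter_pullback_iff {q : G →* Multiplicative V} (S : Submodule ℤ V) (g : G)
    (hq : IsCentralQuotient q) :
    QuotientGroup.mk' (Subgroup.center G) g ∈ modCenter (pullback q S) ↔ (q g).toAdd ∈ S := by
  rw [modCenter, ← Subgroup.mem_comap, Subgroup.comap_map_eq, QuotientGroup.ker_mk',
    sup_eq_left.mpr (hq.center_le_pullback S), mem_pullback]

theorem isCompl_of_isCompl_modCenter {q : G →* Multiplicative V} (hq : IsCentralQuotient q)
    {S T : Submodule ℤ V} (h : IsCompl (modCenter (pullback q S)) (modCenter (pullback q T))) :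
    IsCompl S T := by
  constructor
  · rw [Submodule.disjoint_def]
    intro v hS hT
    obtain ⟨g, rfl⟩ := hq.exists_lift v
    have := Subgroup.disjoint_def.mp h.disjoint ((mk_mem_modCenter_pullback_iff S g hq).mpr hS)
      ((mk_mem_modCenter_pullback_iff T g hq).mpr hT)
    rw [hq.toAdd_eq_zero_iff]
    rwa [← MonoidHom.mem_ker, QuotientGroup.ker_mk'] at this
  · rw [codisjoint_iff_le_sup]
    intro v _
    obtain ⟨g, rfl⟩ := hq.exists_lift v
    rw [← mk_mem_modCenter_pullback_iff _ g hq]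
    have hle : modCenter (pullback q S) ⊔ modCenter (pullback q T) ≤
        modCenter (pullback q (S ⊔ T)) :=
      sup_le (Subgroup.map_mono (hq.pullback_le_iff.mpr le_sup_left))
        (Subgroup.map_mono (hq.pullback_le_iff.mpr le_sup_right))
    exact hle (by rw [h.sup_eq_top]; trivial)

variable [Finite G] {q : G →* Multiplicative V} (hq : IsCentralQuotient q)
include hq

omit [Finite G] in
theorem isCompl_of_mem_atoms (h2 : P2 G) {S T : Submodule ℤ V} (hS : pullback q S ∈ atoms G)
    (hT : pullback q T ∈ atoms G) (hne : S ≠ T) : IsCompl S T :=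
  isCompl_of_isCompl_modCenter hq
    (h2 _ hS _ hT fun h => hne (hq.pullback_injective h)).2.2.2

theorem ne_bot_of_mem_atoms {S : Submodule ℤ V} (hS : pullback q S ∈ atoms G) : S ≠ ⊥ := by
  rintro rfl
  rw [hq.pullback_bot] at hS
  exact (center_lt_of_mem_atoms hS).false

theorem exists_pullback_eq_of_mem_atoms {M : Subgroup G} (hM : M ∈ atoms G) :
    ∃ S : Submodule ℤ V, pullback q S = M :=
  hq.exists_pullback_eq (center_lt_of_mem_atoms hM).le

variable {B : V →+ V →+ Additive (Subgroup.center G)} (hB : IsCommutatorForm q B)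
include hB

/-- An abelian atom is its own centralizer. The centralizer is a member of the Chermak-Delgado
lattice that contains the atom; it is not another atom, as that would be complementary, and not
the maximum, as then `S` and `T` would centralize `S`, which is not central. -/
theorem orthogonal_eq_self_of_abelian_atom (hCD : IsQuasiAntichain (CD G)) (h2 : P2 G)
    {S T : Submodule ℤ V} (hS : pullback q S ∈ abelianAtoms G) (hT : pullback q T ∈ atoms G)
    (hne : S ≠ T) : orthogonal B S = S := by
  have hiso : S ≤ orthogonal B S := (hB.commute_pullback_iff hq S).mp hS.2
  have hbot : S ≠ ⊥ := ne_bot_of_mem_atoms hq hS.1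
  have hcompl := isCompl_of_mem_atoms hq h2 hS.1 hT hne
  have hmem : pullback q (orthogonal B S) ∈ CD G := by
    intro K
    refine (hS.1.1 K).trans ?_
    rw [hB.measure_pullback hq, hB.measure_pullback hq, mul_comm (Nat.card S)]
    refine Nat.mul_le_mul_left _ (Nat.mul_le_mul_left _ ?_)
    have : Finite V := Finite.of_surjective _ hq.surjective
    refine Nat.card_mono (Set.toFinite _) ?_
    intro v hv w hw
    rw [hB.antisymm hq, hw v hv, neg_zero]
  rcases hCD.min_or_max_or_atom ⟨_, hmem⟩ with h | h | h
  · exact le_antisymm (hq.pullback_le_iff.mp (h ⟨_, hS.1.1⟩)) hiso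
  · have hTle : T ≤ orthogonal B S := hq.pullback_le_iff.mp (h ⟨_, hT.1⟩)
    have htop : orthogonal B S = ⊤ := by
      rw [eq_top_iff, ← hcompl.sup_eq_top]
      exact sup_le hiso hTle
    refine absurd ?_ hbot
    rw [eq_bot_iff]
    intro v hv
    rw [Submodule.mem_bot]
    refine hB.nondegenerate hq v fun w => ?_
    have hw : w ∈ orthogonal B S := by rw [htop]; trivial
    rw [hB.antisymm hq, hw v hv, neg_zero]
  · by_contra hne'
    have hc := isCompl_of_mem_atoms hq h2 hS.1 ⟨hmem, h⟩ (Ne.symm hne')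
    exact hbot (hc.disjoint.eq_bot_of_le hiso)

theorem pullback_mem_CD_iff {S₁ : Submodule ℤ V} (hS₁ : pullback q S₁ ∈ CD G)
    (hcard : Nat.card S₁ * Nat.card (orthogonal B S₁) = Nat.card V) (S : Submodule ℤ V) :
    pullback q S ∈ CD G ↔ Nat.card S * Nat.card (orthogonal B S) = Nat.card V := by
  have hZ : 0 < Nat.card (Subgroup.center G) ^ 2 := pow_pos Nat.card_pos 2
  constructor
  · intro hS
    have h := le_antisymm (hS₁ (pullback q S)) (hS (pullback q S₁))
    rw [hB.measure_pullback hq, hB.measure_pullback hq, hcard] at h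
    exact Nat.eq_of_mul_eq_mul_left hZ h
  · intro h K
    refine (hS₁ K).trans_eq ?_
    rw [hB.measure_pullback hq, hB.measure_pullback hq, hcard, h]

/-- Let `S₁` be an abelian atom and `S₂` another atom of the same order. As `S₁` is its own
orthogonal, the maximal measure is `|Z(G)|² |S₁|² = |Z(G)|² |V|`, so the atoms are the preimages
of the proper nontrivial subspaces of maximal measure. -/
theorem pullback_mem_atoms_iff (hCD : IsQuasiAntichain (CD G)) (h2 : P2 G)
    {S₁ S₂ : Submodule ℤ V} (hS₁ : pullback q S₁ ∈ abelianAtoms G)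
    (hS₂ : pullback q S₂ ∈ atoms G) (hne : S₁ ≠ S₂) (hcard : Nat.card S₁ = Nat.card S₂)
    (S : Submodule ℤ V) : pullback q S ∈ atoms G ↔ S ∈ maximalSubmodules B := by
  have hcompl := isCompl_of_mem_atoms hq h2 hS₁.1 hS₂ hne
  have hCD_iff := pullback_mem_CD_iff hq hB hS₁.1.1 (by
    rw [orthogonal_eq_self_of_abelian_atom hq hB hCD h2 hS₁ hS₂ hne]
    nth_rw 2 [hcard]
    exact card_mul_card_of_isCompl hcompl)
  constructor
  · refine fun hS => ⟨ne_bot_of_mem_atoms hq hS, ?_, (hCD_iff S).mp hS.1⟩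
    rintro rfl
    -- If the whole space were an atom, any other atom would be complementary to it, hence trivial.
    have key : ∀ T : Submodule ℤ V, pullback q T ∈ atoms G → ⊤ = T := by
      intro T hT
      by_contra h
      exact ne_bot_of_mem_atoms hq hT
        ((isCompl_of_mem_atoms hq h2 hS hT h).disjoint.eq_bot_of_ge le_top)
    exact hne ((key _ hS₁.1).symm.trans (key _ hS₂))
  · rintro ⟨hbot, htop, hS⟩
    refine ⟨(hCD_iff S).mpr hS, ?_⟩
    have hbot_mem : pullback q ⊥ ∈ CD G := (hCD_iff ⊥).mpr (by
      rw [orthogonal_bot, Nat.card_congr (Submodule.topEquiv (R := ℤ) (M := V)).toEquiv]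
      simp)
    have htop_mem : pullback q ⊤ ∈ CD G := (hCD_iff ⊤).mpr (by
      rw [hB.orthogonal_top hq, Nat.card_congr (Submodule.topEquiv (R := ℤ) (M := V)).toEquiv]
      simp)
    rcases hCD.min_or_max_or_atom ⟨_, (hCD_iff S).mpr hS⟩ with h | h | h
    · exact absurd (eq_bot_iff.mpr (hq.pullback_le_iff.mp (h ⟨_, hbot_mem⟩))) hbot
    · exact absurd (eq_top_iff.mpr (hq.pullback_le_iff.mp (h ⟨_, htop_mem⟩))) htop
    · exact h

end Lattice

/-! ### Coordinates given by three abelian atoms -/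

/-- The counts of atoms, once `G / Z(G)` is identified with `U × U` in such a way that three
abelian atoms are the preimages of the two axes and the diagonal. -/
theorem ncard_atoms_of_coordinates {G U : Type*} [Group G] [Finite G] [AddCommGroup U]
    {q : G →* Multiplicative (U × U)} (hq : IsCentralQuotient q)
    (hCD : IsQuasiAntichain (CD G)) (h2 : P2 G) {M₁ M₂ M₃ : Subgroup G}
    (hM₁ : M₁ ∈ abelianAtoms G) (hM₂ : M₂ ∈ abelianAtoms G) (hM₃ : M₃ ∈ abelianAtoms G)
    (h₁ : ∀ g, g ∈ M₁ ↔ (q g).toAdd.2 = 0) (h₂ : ∀ g, g ∈ M₂ ↔ (q g).toAdd.1 = 0)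
    (h₃ : ∀ g, g ∈ M₃ ↔ (q g).toAdd.1 = (q g).toAdd.2)
    {p : ℕ} (hp : p.Prime) (hpU : ∀ u : U, p • u = 0) :
    ∃ a b : ℕ, 0 < a ∧ 0 < b ∧ (atoms G).ncard = p ^ a + 1 ∧
      (abelianAtoms G).ncard = p ^ b + 1 ∧ (a = b ∨ a = 2 * b) ∧
      ∀ n : ℕ, Nat.card U = p ^ n → a ∣ n := by
  obtain ⟨B, hB : IsCommutatorForm q B⟩ := hq.exists_commutatorForm
  have : Finite (U × U) := Finite.of_surjective _ hq.surjective
  have : Nontrivial U := by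
    by_contra hU
    rw [not_nontrivial_iff_subsingleton] at hU
    refine (center_lt_of_mem_atoms hM₁.1).not_ge fun g _ => ?_
    exact (hq.toAdd_eq_zero_iff g).mp (Subsingleton.elim _ _)
  have : Finite U := Finite.of_surjective (Prod.fst : U × U → U) Prod.fst_surjective
  have hiso : ∀ {M : Subgroup G}, M ∈ abelianAtoms G → ∀ {x y : U × U},
      (∀ g, (q g).toAdd = x → g ∈ M) → (∀ g, (q g).toAdd = y → g ∈ M) → B x y = 0 := by
    intro M hM x y hx hy
    obtain ⟨g, hg⟩ := hq.exists_lift x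
    obtain ⟨k, hk⟩ := hq.exists_lift y
    have := (hB.apply_eq_zero_iff g k).mpr (hM.2 g (hx g hg) k (hy k hk))
    rwa [hg, hk] at this
  have hT : IsTripleIsotropic B :=
    { antisymm := hB.antisymm hq
      nondegenerate := hB.nondegenerate hq
      horizontal := fun u v => hiso hM₁ (fun g hg => by rw [h₁, hg])
        (fun g hg => by rw [h₁, hg])
      vertical := fun u v => hiso hM₂ (fun g hg => by rw [h₂, hg])
        (fun g hg => by rw [h₂, hg])
      diagonal := fun u v => hiso hM₃ (fun g hg => by rw [h₃, hg])
        (fun g hg => by rw [h₃, hg]) }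
  have hpull₁ : pullback q (Submodule.prod ⊤ ⊥) = M₁ := by
    ext g
    simp [mem_pullback, Submodule.mem_prod, h₁]
  have hpull₂ : pullback q (Submodule.prod ⊥ ⊤) = M₂ := by
    ext g
    simp [mem_pullback, Submodule.mem_prod, h₂]
  obtain ⟨u, hu⟩ := exists_ne (0 : U)
  have hne : (Submodule.prod ⊤ ⊥ : Submodule ℤ (U × U)) ≠ Submodule.prod ⊥ ⊤ := by
    intro h
    have : ((u, 0) : U × U) ∈ (Submodule.prod ⊥ ⊤ : Submodule ℤ (U × U)) := by
      rw [← h]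
      simp
    exact hu (by simpa using this)
  have hcard : Nat.card (Submodule.prod ⊤ ⊥ : Submodule ℤ (U × U)) =
      Nat.card (Submodule.prod ⊥ ⊤ : Submodule ℤ (U × U)) :=
    Nat.card_congr ((Equiv.prodComm U U).subtypeEquiv fun x => by
      simp [Submodule.mem_prod])
  have hatoms := pullback_mem_atoms_iff hq hB hCD h2 (hpull₁ ▸ hM₁) (hpull₂ ▸ hM₂.1) hne hcard
  have hatoms_eq : atoms G = pullback q '' maximalSubmodules B := by
    ext M
    constructor
    · intro hM
      obtain ⟨S, rfl⟩ := exists_pullback_eq_of_mem_atoms hq hM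
      exact ⟨S, (hatoms S).mp hM, rfl⟩
    · rintro ⟨S, hS, rfl⟩
      exact (hatoms S).mpr hS
  have habelian_eq : abelianAtoms G = pullback q '' isotropicMaximalSubmodules B := by
    ext M
    constructor
    · rintro ⟨hM, hcomm⟩
      obtain ⟨S, rfl⟩ := exists_pullback_eq_of_mem_atoms hq hM
      exact ⟨S, ⟨(hatoms S).mp hM, (hB.commute_pullback_iff hq S).mp hcomm⟩, rfl⟩
    · rintro ⟨S, ⟨hS, hS'⟩, rfl⟩
      exact ⟨(hatoms S).mpr hS, (hB.commute_pullback_iff hq S).mpr hS'⟩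
  rw [hatoms_eq, habelian_eq, Set.ncard_image_of_injective _ hq.pullback_injective,
    Set.ncard_image_of_injective _ hq.pullback_injective]
  exact hT.ncard_maximalSubmodules (fun S hS T hT' h =>
    isCompl_of_mem_atoms hq h2 ((hatoms S).mpr hS) ((hatoms T).mpr hT') h) hp hpU

end ChermakDelgado

theorem mainTheorem1 {G : Type*} [Group G] [Finite G] (p : ℕ) (hp : p.Prime)
    (hG : IsPGroup p G)
    (h1 : ChermakDelgado.P1 p G) (h2 : ChermakDelgado.P2 G) (h3 : ChermakDelgado.P3 p G)
    (hCD : ChermakDelgado.IsQuasiAntichain (ChermakDelgado.CD G))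
    (w t : ℕ) (hw : (ChermakDelgado.atoms G).ncard = w)
    (ht : (ChermakDelgado.abelianAtoms G).ncard = t) (ht2 : 2 < t) :
    ∃ a b : ℕ, 0 < a ∧ 0 < b ∧ w = p ^ a + 1 ∧ t = p ^ b + 1 ∧ (a = b ∨ a = 2 * b) ∧
      ∀ n : ℕ, Nat.card (G ⧸ Subgroup.center G) = p ^ (2 * n) → a ∣ n := by
  open ChermakDelgado in
  obtain ⟨⟨hcomm, hpow⟩, -⟩ := h1
  let _ : CommGroup (G ⧸ Subgroup.center G) :=
    { (inferInstance : Group (G ⧸ Subgroup.center G)) with mul_comm := hcomm }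
  -- The quotient map, with its abelian target written additively.
  let q₀ : G →* Multiplicative (Additive (G ⧸ Subgroup.center G)) :=
    QuotientGroup.mk' (Subgroup.center G)
  have hq₀ : IsCentralQuotient q₀ :=
    ⟨QuotientGroup.mk'_surjective _, QuotientGroup.ker_mk' _⟩
  rw [← ht, Set.two_lt_ncard_iff] at ht2
  obtain ⟨M₁, M₂, M₃, hM₁, hM₂, hM₃, h12, h13, h23⟩ := ht2
  obtain ⟨S₁, rfl⟩ := exists_pullback_eq_of_mem_atoms hq₀ hM₁.1
  obtain ⟨S₂, rfl⟩ := exists_pullback_eq_of_mem_atoms hq₀ hM₂.1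
  obtain ⟨S₃, rfl⟩ := exists_pullback_eq_of_mem_atoms hq₀ hM₃.1
  have hcompl : ∀ {S T}, pullback q₀ S ∈ abelianAtoms G → pullback q₀ T ∈ abelianAtoms G →
      pullback q₀ S ≠ pullback q₀ T → IsCompl S T := fun hS hT hne =>
    isCompl_of_mem_atoms hq₀ h2 hS.1 hT.1 fun h => hne (congrArg _ h)
  obtain ⟨e, he₁, he₂, he₃⟩ := exists_equiv_prod_of_isCompl (hcompl hM₁ hM₂ h12)
    (hcompl hM₁ hM₃ h13) (hcompl hM₂ hM₃ h23)
  -- The same quotient in the coordinates that turn the three atoms into the axes and the diagonal.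
  let q : G →* Multiplicative (S₁ × S₁) := (AddMonoidHom.toMultiplicative e.toAddMonoidHom).comp q₀
  have hq : IsCentralQuotient q := by
    refine ⟨fun x => ?_, ?_⟩
    · obtain ⟨g, hg⟩ := hq₀.exists_lift (e.symm x.toAdd)
      exact ⟨g, (congrArg e hg).trans (e.apply_symm_apply _)⟩
    · ext g
      rw [← hq₀.toAdd_eq_zero_iff, MonoidHom.mem_ker]
      exact e.map_eq_zero_iff
  obtain ⟨a, b, ha, hb, hwa, htb, hab, hn⟩ := ncard_atoms_of_coordinates hq hCD h2 hM₁ hM₂ hM₃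
    (fun g => he₁ _) (fun g => he₂ _) (fun g => he₃ _) hp
    (fun u => Subtype.ext (hpow (Additive.toMul u.1)))
  refine ⟨a, b, ha, hb, hw.symm.trans hwa, ht.symm.trans htb, hab, fun n hcard => hn n ?_⟩
  have h : Nat.card (G ⧸ Subgroup.center G) = Nat.card S₁ * Nat.card S₁ := by
    rw [← Nat.card_prod]
    exact Nat.card_congr (Additive.ofMul.trans e.toEquiv)
  rw [hcard, mul_comm, pow_mul, sq] at h
  exact (Nat.mul_self_inj.mp h).symm
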